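/- Let $p$ be the order, $S_Q(x)=\sqrt{|x|}\,\mathrm{sgn}(x)$ and $\rho_\tau(x)=x[\tau-I(x<0)]$. Let $\{y_t\}_{t\in\mathbb Z}$ be a real process, $\mathcal F_t=\sigma(y_s,\ s\le t)$, and suppose that it follows the quantile double autoregression: for continuous functions $\phi_i,b,\beta_j:(0,1)\to\mathbb R$ ($1\le i,j\le p$), the $u$-th conditional quantile of $y_t$ given $\mathcal F_{t-1}$ is, for all $0<u<1$ and all $t$, $$Q_u(y_t\mid\mathcal F_{t-1})=\sum_{i=1}^p\phi_i(u)y_{t-i}+S_Q\Big(b(u)+\sum_{j=1}^p\beta_j(u)y_{t-j}^2\Big)\quad\text{a.s.}$$ Fix $\tau\in(0,1)$, and let $\theta_{\tau0}=(\phi_1(\tau),\dots,\phi_p(\tau),b(\tau),\beta_1(\tau),\dots,\beta_p(\tau))'$ be an interior point of a compact set $\Theta\subset\mathbb R^{2p+1}$. For $\theta=(\phi',b,\beta')'\in\Theta$ put $q_t(\theta)=\sum_{i=1}^p\phi_iy_{t-i}+S_Q(b+\sum_{j=1}^p\beta_jy_{t-j}^2)$, and let $$\widehat\theta_{\tau n}\in\operatorname*{argmin}_{\theta\in\Theta}\sum_{t=p+1}^n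 w_t\,\rho_\tau\big(y_t-q_t(\theta)\big)$$ be a self-weighted conditional quantile estimator with random weights $\{w_t\}$. Assume: (a) $\{y_t\}$ is strictly stationary and ergodic, and $E|y_t|^\kappa<\infty$ for some $0<\kappa\le1$; (b) $\{w_t\}$ is strictly stationary (jointly with $\{y_t\}$) and ergodic; $w_t$ is nonnegative, not almost surely zero, and $\mathcal F_{t-1}$-measurable, with $E[w_t]<\infty$ and $E[w_t\|(y_{t-1},\dots,y_{t-p})\|^3]<\infty$, where $\|\cdot\|$ is the Euclidean norm; (c) for each $t$, with probability one the conditional distribution of $y_t$ given $\mathcal F_{t-1}$, with distribution function $F_{t-1}$, has a differentiable density $f_{t-1}$ on $\mathbb R$ such that $f_{t-1}$ and its derivative are bounded and $f_{t-1}>0$ on $\{x:0<F_{t-1}(x)<1\}$; (d) $\min\{|b(\tau)|,|\beta_1(\tau)|,\dots,|\beta_p(\tau)|\}\ge C$ for a constant $C>0$. Then $\widehat\theta_{\tau n}\to\theta_{\tau0}$ almost surely as $n\to\infty$. -/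

import Mathlib

open MeasureTheory ProbabilityTheory Filter Topology Set

noncomputable section

namespace QDAR

/-- The signed square root `S_Q(x) = √|x| · sgn(x)`. -/
def signedSqrt (x : ℝ) : ℝ := √|x| * (SignType.sign x : ℝ)

/-- The check function `ρ_τ(x) = x (τ - 1{x < 0})`. -/
def checkLoss (τ x : ℝ) : ℝ := x * (τ - if x < 0 then 1 else 0)

/-- The parameter vectors `θ = (φ', b, β')'` of `ℝ^p × ℝ × ℝ^p = ℝ^(2p+1)`. -/
abbrev Param (p : ℕ) : Type := (Fin p → ℝ) × ℝ × (Fin p → ℝ)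

section Processes

variable {Ω E : Type*} [MeasurableSpace Ω] [MeasurableSpace E]

/-- The left shift on two-sided sequences. -/
def shift (x : ℤ → E) : ℤ → E := fun t => x (t + 1)

/-- The law of a process, as a measure on the space of its paths. -/
def pathLaw (P : Measure Ω) (X : ℤ → Ω → E) : Measure (ℤ → E) :=
  P.map (fun ω t => X t ω)

/-- Strict stationarity: the law of the process is invariant under the shift. -/
def StrictlyStationary (P : Measure Ω) (X : ℤ → Ω → E) : Prop :=
  MeasurePreserving shift (pathLaw P X) (pathLaw P X)

/-- Strict stationarity and ergodicity: the shift is measure preserving and ergodic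
for the law of the process. -/
def StationaryErgodic (P : Measure Ω) (X : ℤ → Ω → E) : Prop :=
  Ergodic shift (pathLaw P X)

end Processes

section Conditioning

variable {Ω : Type*} [MeasurableSpace Ω]

/-- The observed past `(y_t, y_{t-1}, y_{t-2}, …)` at time `t`. -/
def past (y : ℤ → Ω → ℝ) (t : ℤ) (ω : Ω) : ℕ → ℝ := fun k => y (t - k) ω

/-- The σ-field `𝓕_t` generated by `{y_s : s ≤ t}`. -/
abbrev pastSigma (y : ℤ → Ω → ℝ) (t : ℤ) : MeasurableSpace Ω :=
  MeasurableSpace.comap (past y t) inferInstance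

/-- The (regular) conditional distribution of `y_t` given `𝓕_{t-1}`, at the outcome `ω`. -/
def condLaw (P : Measure Ω) [IsFiniteMeasure P] (y : ℤ → Ω → ℝ) (t : ℤ) (ω : Ω) : Measure ℝ :=
  condDistrib (y t) (past y (t - 1)) P (past y (t - 1) ω)

/-- The `u`-th quantile `inf {x : F(x) ≥ u}` of a law on `ℝ` with distribution function `F`. -/
def quantile (μ : Measure ℝ) (u : ℝ) : ℝ := sInf {x : ℝ | u ≤ μ.real (Iic x)}

/-- `μ` has a differentiable density `f` such that `f` and its derivative are bounded, and `f` is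
positive on `{x : 0 < F(x) < 1}`, where `F` is the distribution function of `μ`. -/
def RegularDensity (μ : Measure ℝ) : Prop :=
  ∃ f : ℝ → ℝ, (∀ x, 0 ≤ f x) ∧
    μ = volume.withDensity (fun x => ENNReal.ofReal (f x)) ∧
    Differentiable ℝ f ∧
    (∃ M : ℝ, ∀ x, |f x| ≤ M ∧ |deriv f x| ≤ M) ∧
    ∀ x, 0 < μ.real (Iic x) → μ.real (Iic x) < 1 → 0 < f x

end Conditioning

section Model

variable {Ω : Type*} [MeasurableSpace Ω]

/-- The vector of lags `y_{1,t-1} = (y_{t-1}, …, y_{t-p})'`. -/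
def lags (p : ℕ) (y : ℤ → Ω → ℝ) (t : ℤ) (ω : Ω) : Fin p → ℝ :=
  fun i => y (t - 1 - (i : ℤ)) ω

/-- The Euclidean norm `‖y_{1,t-1}‖`. -/
def lagsNorm (p : ℕ) (y : ℤ → Ω → ℝ) (t : ℤ) (ω : Ω) : ℝ :=
  √(∑ i, lags p y t ω i ^ 2)

/-- `q(θ; v) = v'φ + S_Q(b + ∑ β_j v_j²)` for `θ = (φ', b, β')'` and a vector of lags `v`. -/
def condQuantileFun {p : ℕ} (θ : Param p) (v : Fin p → ℝ) : ℝ :=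
  (∑ i, θ.1 i * v i) + signedSqrt (θ.2.1 + ∑ j, θ.2.2 j * v j ^ 2)

/-- The parameter vector `θ_u = (φ(u)', b(u), β(u)')'` at the quantile level `u`. -/
def paramAt {p : ℕ} (φ : Fin p → ℝ → ℝ) (b : ℝ → ℝ) (β : Fin p → ℝ → ℝ) (u : ℝ) : Param p :=
  (fun i => φ i u, b u, fun j => β j u)

/-- `y` follows the quantile double autoregression of order `p` with coefficient functions
`φ_i`, `b`, `β_j` on `(0, 1)`: these are continuous, and for every level `u ∈ (0, 1)`,
`Q_u(y_t | 𝓕_{t-1}) = ∑ φ_i(u) y_{t-i} + S_Q(b(u) + ∑ β_j(u) y_{t-j}²)` almost surely. -/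
structure IsQDAR (P : Measure Ω) [IsFiniteMeasure P] (y : ℤ → Ω → ℝ) {p : ℕ}
    (φ : Fin p → ℝ → ℝ) (b : ℝ → ℝ) (β : Fin p → ℝ → ℝ) : Prop where
  continuousOn_φ : ∀ i, ContinuousOn (φ i) (Ioo 0 1)
  continuousOn_b : ContinuousOn b (Ioo 0 1)
  continuousOn_β : ∀ j, ContinuousOn (β j) (Ioo 0 1)
  quantile_eq : ∀ t : ℤ, ∀ u ∈ Ioo (0 : ℝ) 1, ∀ᵐ ω ∂P,
    quantile (condLaw P y t ω) u = condQuantileFun (paramAt φ b β u) (lags p y t ω)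

/-- The objective function `∑_{t=p+1}^n w_t ρ_τ(y_t - q_t(θ))`. -/
def objective {p : ℕ} (y w : ℤ → Ω → ℝ) (τ : ℝ) (n : ℕ) (θ : Param p) (ω : Ω) : ℝ :=
  ∑ t ∈ Finset.Icc (p + 1) n,
    w (t : ℤ) ω * checkLoss τ (y (t : ℤ) ω - condQuantileFun θ (lags p y (t : ℤ) ω))

/-- `est n` is, for every sample size `n`, a minimizer of the objective function over the
parameter space `Θ` (almost surely), i.e. a self-weighted conditional quantile estimator. -/
def IsSelfWeightedCQE {p : ℕ} (P : Measure Ω) (y w : ℤ → Ω → ℝ) (τ : ℝ) (Θ : Set (Param p))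
    (est : ℕ → Ω → Param p) : Prop :=
  ∀ᵐ ω ∂P, ∀ n, est n ω ∈ Θ ∧ ∀ θ ∈ Θ, objective y w τ n (est n ω) ω ≤ objective y w τ n θ ω

end Model

end QDAR

end

open QDAR

/-! This is Wald's consistency argument. The objective at `θ` minus the objective at `θ₀` is a sum
of terms `w_t * lossGap`. Since `ρ_τ` is 1-Lipschitz, each term is at most a constant times `w_t (1
+ ‖lags‖)`, so it is integrable even if `y_t` has no mean.

Its mean is positive for `θ ≠ θ₀` (`integral_mul_lossGap_pos`). Given the past, the `τ`-quantile is
the only minimizer of the expected check loss, so a zero mean would force the two quantile functions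
to agree wherever `w_t ≠ 0`. The conditional laws have no atoms, so the lag vector almost surely
avoids the zero set of any given nonzero polynomial (`ae_eval_ne_zero`). Agreement with positive
probability thus becomes polynomial identities, which give `θ = θ₀` because `b(τ) ≠ 0`.

Sums of an ergodic sequence with positive mean tend to infinity
(`Ergodic.tendsto_birkhoffSum_atTop`, from the maximal ergodic theorem); this one-sided statement is
enough. Applied to a lower bound uniform over a small ball, it excludes minimizers from that ball
for large `n`; compactness of `Θ` leaves finitely many balls to exclude. -/

/-! ### Drift of Birkhoff sums -/

section BirkhoffDrift

variable {α : Type*}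

/-- The maximum of `0` and the Birkhoff sums of `f` of length at most `n`, defined recursively. -/
def birkhoffMax (T : α → α) (f : α → ℝ) : ℕ → α → ℝ
  | 0 => fun _ => 0
  | n + 1 => fun x => max 0 (f x + birkhoffMax T f n (T x))

theorem birkhoffMax_nonneg (T : α → α) (f : α → ℝ) (n : ℕ) (x : α) : 0 ≤ birkhoffMax T f n x := by
  cases n with
  | zero => exact le_rfl
  | succ n => exact le_max_left _ _

theorem birkhoffMax_le_succ (T : α → α) (f : α → ℝ) (n : ℕ) (x : α) :
    birkhoffMax T f n x ≤ birkhoffMax T f (n + 1) x := by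
  induction n generalizing x with
  | zero => exact birkhoffMax_nonneg T f 1 x
  | succ n ih => exact max_le_max le_rfl (add_le_add le_rfl (ih (T x)))

theorem birkhoffSum_le_birkhoffMax (T : α → α) (f : α → ℝ) (n : ℕ) (x : α) :
    birkhoffSum T f n x ≤ birkhoffMax T f n x := by
  induction n generalizing x with
  | zero => simp [birkhoffMax]
  | succ n ih =>
    rw [birkhoffSum_succ']
    exact (add_le_add le_rfl (ih (T x))).trans (le_max_right _ _)

/-- Makes the event of bounded maxima exactly `T`-invariant, so that ergodicity gives it measure
zero or full measure. -/
theorem bddAbove_birkhoffMax_comp_iff (T : α → α) (f : α → ℝ) (x : α) :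
    BddAbove (range fun n => birkhoffMax T f n (T x)) ↔
      BddAbove (range fun n => birkhoffMax T f n x) := by
  constructor
  · rintro ⟨B, hB⟩
    refine ⟨max 0 (f x + B), ?_⟩
    rintro _ ⟨n, rfl⟩
    refine (birkhoffMax_le_succ T f n x).trans (max_le_max le_rfl (add_le_add le_rfl ?_))
    exact hB ⟨n, rfl⟩
  · rintro ⟨B, hB⟩
    refine ⟨B - f x, ?_⟩
    rintro _ ⟨n, rfl⟩
    have h1 : birkhoffMax T f (n + 1) x ≤ B := hB ⟨n + 1, rfl⟩
    have h2 : f x + birkhoffMax T f n (T x) ≤ birkhoffMax T f (n + 1) x := le_max_right _ _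
    show birkhoffMax T f n (T x) ≤ B - f x
    linarith

variable [MeasurableSpace α] {μ : Measure α} {T : α → α} {f : α → ℝ}

theorem measurable_birkhoffMax (hT : Measurable T) (hf : Measurable f) (n : ℕ) :
    Measurable (birkhoffMax T f n) := by
  induction n with
  | zero => exact measurable_const
  | succ n ih => exact measurable_const.max (hf.add (ih.comp hT))

theorem integrable_birkhoffMax [IsFiniteMeasure μ] (hT : MeasurePreserving T μ μ)
    (hf : Integrable f μ) (n : ℕ) : Integrable (birkhoffMax T f n) μ := by
  induction n with
  | zero => exact integrable_const _
  | succ n ih =>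
    exact (integrable_const (0 : ℝ)).sup (hf.add (hT.integrable_comp_of_integrable ih))

/-- A form of the maximal ergodic theorem: if the running maxima of the Birkhoff sums are
almost surely unbounded, then the integral is nonnegative. -/
theorem integral_nonneg_of_birkhoffMax_unbounded [IsFiniteMeasure μ]
    (hT : MeasurePreserving T μ μ) (hf : Integrable f μ)
    (h : ∀ᵐ x ∂μ, ¬ BddAbove (range fun n => birkhoffMax T f n x)) : 0 ≤ ∫ x, f x ∂μ := by
  -- The integrand is `max (f x) (-M_n (T x))`, where `M_n` is `birkhoffMax T f n`. It is dominated
  -- by `|f|` and equals `f x` once `M_n (T x) ≥ -f x`. Its integral is `∫ M_{n+1} - ∫ M_n ≥ 0` by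
  -- invariance of `μ`.
  have hlim : Tendsto (fun n => ∫ x, (birkhoffMax T f (n + 1) x - birkhoffMax T f n (T x)) ∂μ)
      atTop (𝓝 (∫ x, f x ∂μ)) := by
    refine tendsto_integral_of_dominated_convergence (fun x => |f x|) ?_ hf.abs ?_ ?_
    · intro n
      exact ((integrable_birkhoffMax hT hf (n + 1)).sub
        (hT.integrable_comp_of_integrable (integrable_birkhoffMax hT hf n))).aestronglyMeasurable
    · intro n
      refine Eventually.of_forall fun x => ?_
      have h0 := birkhoffMax_nonneg T f n (T x)
      show |max 0 (f x + birkhoffMax T f n (T x)) - birkhoffMax T f n (T x)| ≤ |f x|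
      rcases le_total 0 (f x + birkhoffMax T f n (T x)) with h1 | h1
      · rw [max_eq_right h1]; simp
      · rw [max_eq_left h1, zero_sub, abs_neg, abs_of_nonneg h0, abs_of_nonpos (by linarith)]
        linarith
    · filter_upwards [h] with x hx
      rw [← bddAbove_birkhoffMax_comp_iff] at hx
      obtain ⟨N, hN⟩ : ∃ N, - f x < birkhoffMax T f N (T x) := by
        by_contra! hcon
        exact hx ⟨- f x, by rintro _ ⟨n, rfl⟩; exact hcon n⟩
      refine tendsto_const_nhds.congr' ?_
      filter_upwards [eventually_ge_atTop N] with n hn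
      have hmono : Monotone fun n => birkhoffMax T f n (T x) :=
        monotone_nat_of_le_succ fun n => birkhoffMax_le_succ T f n (T x)
      have h1 : birkhoffMax T f N (T x) ≤ birkhoffMax T f n (T x) := hmono hn
      show f x = max 0 (f x + birkhoffMax T f n (T x)) - birkhoffMax T f n (T x)
      rw [max_eq_right (by linarith)]
      ring
  refine ge_of_tendsto' hlim fun n => ?_
  have hn := integrable_birkhoffMax hT hf n
  have hnT : Integrable (fun x => birkhoffMax T f n (T x)) μ := hT.integrable_comp_of_integrable hn
  have hi : ∫ x, birkhoffMax T f n (T x) ∂μ = ∫ x, birkhoffMax T f n x ∂μ := by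
    conv_rhs => rw [← hT.map_eq]
    exact (integral_map hT.measurable.aemeasurable (by rw [hT.map_eq]; exact hn.1)).symm
  rw [integral_sub (integrable_birkhoffMax hT hf (n + 1)) hnT, hi,
    sub_nonneg]
  exact integral_mono hn (integrable_birkhoffMax hT hf (n + 1)) (birkhoffMax_le_succ T f n)

/-- Birkhoff sums of an integrable function with positive mean tend to infinity almost surely. -/
theorem Ergodic.tendsto_birkhoffSum_atTop [IsProbabilityMeasure μ] (hT : Ergodic T μ)
    (hfm : Measurable f) (hf : Integrable f μ) (hpos : 0 < ∫ x, f x ∂μ) :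
    ∀ᵐ x ∂μ, Tendsto (fun n => birkhoffSum T f n x) atTop atTop := by
  -- Half of the mean is kept as drift: `g = ε - f` still has negative mean, so its maxima are
  -- bounded by some `B`, whence the sums of `f` are at least `n * ε - B`.
  set ε : ℝ := (∫ x, f x ∂μ) / 2 with hε
  have hεpos : 0 < ε := by positivity
  set g : α → ℝ := fun x => ε - f x with hg
  have hgm : Measurable g := measurable_const.sub hfm
  have hgi : Integrable g μ := (integrable_const ε).sub hf
  have hgint : ∫ x, g x ∂μ < 0 := by
    rw [hg, integral_sub (integrable_const ε) hf]
    simp only [integral_const, probReal_univ, one_smul]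
    linarith
  have hms : MeasurableSet {x | BddAbove (range fun n => birkhoffMax T g n x)} :=
    measurableSet_bddAbove_range fun n => measurable_birkhoffMax hT.measurable hgm n
  have hinv : T ⁻¹' {x | BddAbove (range fun n => birkhoffMax T g n x)} =
      {x | BddAbove (range fun n => birkhoffMax T g n x)} := by
    ext x
    exact bddAbove_birkhoffMax_comp_iff T g x
  have hbdd : ∀ᵐ x ∂μ, BddAbove (range fun n => birkhoffMax T g n x) := by
    rcases hT.toPreErgodic.ae_mem_or_ae_notMem hms hinv with h | h
    · exact h
    · exact absurd (integral_nonneg_of_birkhoffMax_unbounded hT.toMeasurePreserving hgi h)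
        (not_le.mpr hgint)
  filter_upwards [hbdd] with x ⟨B, hB⟩
  have hlow : ∀ n : ℕ, n * ε - B ≤ birkhoffSum T f n x := by
    intro n
    have h1 : birkhoffSum T g n x ≤ B := (birkhoffSum_le_birkhoffMax T g n x).trans (hB ⟨n, rfl⟩)
    have h2 : birkhoffSum T g n x = n * ε - birkhoffSum T f n x := by
      simp [birkhoffSum, hg, Finset.sum_sub_distrib]
    linarith
  refine tendsto_atTop_mono hlow (tendsto_atTop_add_const_right _ _ ?_)
  exact tendsto_natCast_atTop_atTop.atTop_mul_const hεpos

end BirkhoffDrift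

namespace QDAR

/-! ### The check loss and the quantile function of the model -/

theorem measurable_checkLoss (τ : ℝ) : Measurable (checkLoss τ) :=
  measurable_id.mul (measurable_const.sub
    (Measurable.ite measurableSet_Iio measurable_const measurable_const))

/-- The slopes of `ρ_τ` are `τ` and `τ - 1`, both of modulus at most one. The bound does not involve
`x`, so no moment of `y_t` itself enters. -/
theorem abs_checkLoss_sub_le {τ : ℝ} (hτ : τ ∈ Ioo (0 : ℝ) 1) (x q q' : ℝ) :
    |checkLoss τ (x - q) - checkLoss τ (x - q')| ≤ |q - q'| := by
  obtain ⟨h0, h1⟩ := hτ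
  unfold checkLoss
  rcases le_total q q' with h | h
  · rw [abs_of_nonpos (sub_nonpos.mpr h)]
    split_ifs <;> rw [abs_le] <;> constructor <;> nlinarith
  · rw [abs_of_nonneg (sub_nonneg.mpr h)]
    split_ifs <;> rw [abs_le] <;> constructor <;> nlinarith

/-- Valid for both signs because `√` is `0` on negative numbers. -/
theorem signedSqrt_eq (x : ℝ) : signedSqrt x = √x - √(-x) := by
  unfold signedSqrt
  rcases lt_trichotomy x 0 with h | h | h
  · rw [abs_of_neg h, sign_neg h, Real.sqrt_eq_zero_of_nonpos h.le]; simp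
  · simp [h]
  · rw [abs_of_pos h, sign_pos h, Real.sqrt_eq_zero_of_nonpos (x := -x) (by linarith)]; simp

theorem continuous_signedSqrt : Continuous signedSqrt := by
  rw [funext signedSqrt_eq]
  fun_prop

theorem signedSqrt_mul_abs (x : ℝ) : signedSqrt x * |signedSqrt x| = x := by
  rw [signedSqrt_eq]
  rcases le_total x 0 with h | h
  · rw [Real.sqrt_eq_zero_of_nonpos h, zero_sub, abs_neg, abs_of_nonneg (Real.sqrt_nonneg _),
      neg_mul, Real.mul_self_sqrt (by linarith), neg_neg]
  · rw [Real.sqrt_eq_zero_of_nonpos (x := -x) (by linarith), sub_zero,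
      abs_of_nonneg (Real.sqrt_nonneg _), Real.mul_self_sqrt h]

theorem signedSqrt_injective : Function.Injective signedSqrt := fun a b h => by
  rw [← signedSqrt_mul_abs a, h, signedSqrt_mul_abs]

theorem abs_sqrt_sub_sqrt_le (a b : ℝ) : |√a - √b| ≤ √|a - b| := by
  have key : ∀ a b : ℝ, √a ≤ √b + √|a - b| := by
    intro a b
    rcases le_total a b with h | h
    · linarith [Real.sqrt_le_sqrt h, Real.sqrt_nonneg |a - b|]
    rw [abs_of_nonneg (sub_nonneg.mpr h)]
    rcases le_total b 0 with h0 | h0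
    · linarith [Real.sqrt_le_sqrt (show a ≤ a - b by linarith), Real.sqrt_nonneg b]
    · refine Real.sqrt_le_iff.mpr ⟨by positivity, ?_⟩
      nlinarith [Real.sq_sqrt h0, Real.sq_sqrt (sub_nonneg.mpr h), Real.sqrt_nonneg b,
        Real.sqrt_nonneg (a - b)]
  rw [abs_le]
  constructor
  · have := key b a
    rw [abs_sub_comm] at this
    linarith
  · linarith [key a b]

theorem abs_signedSqrt_sub_le (a b : ℝ) : |signedSqrt a - signedSqrt b| ≤ 2 * √|a - b| := by
  have h1 := abs_sqrt_sub_sqrt_le a b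
  have h2 := abs_sqrt_sub_sqrt_le (-b) (-a)
  rw [show -b - -a = a - b by ring] at h2
  rw [signedSqrt_eq, signedSqrt_eq, show √a - √(-a) - (√b - √(-b)) =
    (√a - √b) + (√(-b) - √(-a)) by ring]
  linarith [abs_add_le (√a - √b) (√(-b) - √(-a))]

theorem measurable_condQuantileFun {p : ℕ} (θ : Param p) : Measurable (condQuantileFun θ) := by
  have : Continuous (condQuantileFun θ) := by
    unfold condQuantileFun
    have := continuous_signedSqrt
    fun_prop
  exact this.measurable

/-- A modulus of continuity of the quantile function in the parameter, up to the size of the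
vector of lags. -/
theorem abs_condQuantileFun_sub_le {p : ℕ} {θ θ' : Param p} {r : ℝ} (h : dist θ θ' ≤ r)
    (v : Fin p → ℝ) :
    |condQuantileFun θ v - condQuantileFun θ' v| ≤ (p * r + 2 * √r) * (1 + √(∑ i, v i ^ 2)) := by
  set s : ℝ := √(∑ i, v i ^ 2) with hs
  have hsum : 0 ≤ ∑ i, v i ^ 2 := Finset.sum_nonneg fun i _ => sq_nonneg _
  have hs0 : 0 ≤ s := Real.sqrt_nonneg _
  have hr : 0 ≤ r := dist_nonneg.trans h
  have hvs : ∀ i, |v i| ≤ s := fun i => by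
    rw [← Real.sqrt_sq_eq_abs]
    exact Real.sqrt_le_sqrt
      (Finset.single_le_sum (f := fun i => v i ^ 2) (fun i _ => sq_nonneg _) (Finset.mem_univ i))
  have h1 : ∀ i, |θ.1 i - θ'.1 i| ≤ r := fun i =>
    ((dist_le_pi_dist θ.1 θ'.1 i).trans (le_max_left _ _)).trans h
  have h2 : |θ.2.1 - θ'.2.1| ≤ r := ((le_max_left _ _).trans (le_max_right _ _)).trans h
  have h3 : ∀ i, |θ.2.2 i - θ'.2.2 i| ≤ r := fun i =>
    ((dist_le_pi_dist θ.2.2 θ'.2.2 i).trans ((le_max_right _ _).trans (le_max_right _ _))).trans h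
  have hlin : |∑ i, θ.1 i * v i - ∑ i, θ'.1 i * v i| ≤ p * r * s := by
    rw [← Finset.sum_sub_distrib]
    refine (Finset.abs_sum_le_sum_abs _ _).trans ?_
    calc ∑ i, |θ.1 i * v i - θ'.1 i * v i| ≤ ∑ _i : Fin p, r * s := by
          refine Finset.sum_le_sum fun i _ => ?_
          rw [← sub_mul, abs_mul]
          exact mul_le_mul (h1 i) (hvs i) (abs_nonneg _) hr
      _ = p * r * s := by simp [mul_assoc]
  -- Weakening `r * (1 + s ^ 2)` to `r * (1 + s) ^ 2` lets the square root be taken exactly.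
  have hquad : |(θ.2.1 + ∑ j, θ.2.2 j * v j ^ 2) - (θ'.2.1 + ∑ j, θ'.2.2 j * v j ^ 2)| ≤
      r * (1 + s) ^ 2 := by
    rw [add_sub_add_comm, ← Finset.sum_sub_distrib]
    refine (abs_add_le _ _).trans ?_
    have : |∑ j, (θ.2.2 j * v j ^ 2 - θ'.2.2 j * v j ^ 2)| ≤ r * s ^ 2 := by
      refine (Finset.abs_sum_le_sum_abs _ _).trans ?_
      rw [hs, Real.sq_sqrt hsum, Finset.mul_sum]
      refine Finset.sum_le_sum fun i _ => ?_
      rw [← sub_mul, abs_mul, abs_of_nonneg (sq_nonneg (v i))]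
      exact mul_le_mul_of_nonneg_right (h3 i) (sq_nonneg _)
    nlinarith [mul_nonneg hr hs0]
  have hroot : √|(θ.2.1 + ∑ j, θ.2.2 j * v j ^ 2) - (θ'.2.1 + ∑ j, θ'.2.2 j * v j ^ 2)| ≤
      √r * (1 + s) := by
    refine (Real.sqrt_le_sqrt hquad).trans ?_
    rw [Real.sqrt_mul hr, Real.sqrt_sq (by linarith)]
  unfold condQuantileFun
  rw [add_sub_add_comm]
  refine (abs_add_le _ _).trans ?_
  have h4 := abs_signedSqrt_sub_le (θ.2.1 + ∑ j, θ.2.2 j * v j ^ 2)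
    (θ'.2.1 + ∑ j, θ'.2.2 j * v j ^ 2)
  have h5 : 0 ≤ p * r := by positivity
  nlinarith

/-! ### Quantiles of laws with a regular density -/

section Quantile

variable {μ : Measure ℝ}

/-- The bound `M` on the density is a Lipschitz constant of the distribution function. -/
theorem RegularDensity.continuous_real_Iic [IsProbabilityMeasure μ] (h : RegularDensity μ) :
    Continuous fun x => μ.real (Iic x) := by
  obtain ⟨f, -, hμ, -, ⟨M, hM⟩, -⟩ := h
  have key : ∀ a b, a ≤ b → μ.real (Iic b) - μ.real (Iic a) ≤ M * (b - a) := by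
    intro a b hab
    have h1 : μ.real (Iic b) - μ.real (Iic a) = μ.real (Ioc a b) := by
      rw [← Iic_union_Ioc_eq_Iic hab,
        measureReal_union (Set.Iic_disjoint_Ioc le_rfl) measurableSet_Ioc]
      ring
    rw [h1]
    have h2 : μ (Ioc a b) ≤ ENNReal.ofReal (M * (b - a)) := by
      have hM0 : 0 ≤ M := (abs_nonneg _).trans (hM 0).1
      rw [hμ, withDensity_apply _ measurableSet_Ioc, ENNReal.ofReal_mul hM0, ← Real.volume_Ioc,
        ← setLIntegral_const]
      exact lintegral_mono fun x => ENNReal.ofReal_le_ofReal ((le_abs_self _).trans (hM x).1)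
    have hM0 : 0 ≤ M := (abs_nonneg _).trans (hM 0).1
    exact ENNReal.toReal_le_of_le_ofReal (mul_nonneg hM0 (sub_nonneg.mpr hab)) h2
  have hM0 : 0 ≤ M := (abs_nonneg _).trans (hM 0).1
  have mono : ∀ a b, a ≤ b → μ.real (Iic a) ≤ μ.real (Iic b) := fun a b hab =>
    measureReal_mono (Iic_subset_Iic.mpr hab)
  refine (LipschitzWith.of_dist_le_mul (K := ⟨M, hM0⟩) fun x y => ?_).continuous
  rw [Real.dist_eq, Real.dist_eq]
  show |_| ≤ M * |x - y|
  rcases le_total x y with hxy | hxy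
  · rw [abs_of_nonpos (by linarith [mono x y hxy]), abs_of_nonpos (by linarith)]
    linarith [key x y hxy]
  · rw [abs_of_nonneg (by linarith [mono y x hxy]), abs_of_nonneg (by linarith)]
    linarith [key y x hxy]

theorem RegularDensity.real_Iic_quantile [IsProbabilityMeasure μ] (h : RegularDensity μ) {u : ℝ}
    (hu : u ∈ Ioo (0 : ℝ) 1) : μ.real (Iic (quantile μ u)) = u := by
  have hc := h.continuous_real_Iic
  have hcdf : ∀ x, cdf μ x = μ.real (Iic x) := fun x => cdf_eq_real μ x
  set S : Set ℝ := {x | u ≤ μ.real (Iic x)} with hS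
  have hclosed : IsClosed S := isClosed_le continuous_const hc
  have hne : S.Nonempty := by
    obtain ⟨x, hx⟩ := ((tendsto_cdf_atTop μ).eventually (lt_mem_nhds hu.2)).exists
    exact ⟨x, by rw [hcdf] at hx; exact hx.le⟩
  have hbdd : BddBelow S := by
    obtain ⟨x, hx⟩ := ((tendsto_cdf_atBot μ).eventually (gt_mem_nhds hu.1)).exists
    refine ⟨x, fun z hz => ?_⟩
    by_contra! hlt
    rw [hcdf] at hx
    have h1 : u ≤ μ.real (Iic z) := hz
    have h2 : μ.real (Iic z) ≤ μ.real (Iic x) := measureReal_mono (Iic_subset_Iic.mpr hlt.le)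
    linarith
  refine le_antisymm ?_ (hclosed.csInf_mem hne hbdd)
  by_contra! hgt
  have hev : ∀ᶠ x in 𝓝 (quantile μ u), u < μ.real (Iic x) :=
    hc.continuousAt.eventually (lt_mem_nhds hgt)
  obtain ⟨x, hx, hlt⟩ := ((hev.filter_mono nhdsWithin_le_nhds).and
    (self_mem_nhdsWithin (s := Iio (quantile μ u)))).exists
  exact absurd (csInf_le hbdd (show x ∈ S from hx.le)) (not_le.mpr hlt)

/-- The density is positive on a neighbourhood of `q`, which meets `Ioo a b` in a nonempty open set
even when `q` is an endpoint; the endpoint case is the one used for the quantile. -/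
theorem RegularDensity.measure_Ioo_pos (h : RegularDensity μ) {a b q : ℝ}
    (hab : a < b) (hq : q ∈ Icc a b) (h0 : 0 < μ.real (Iic q)) (h1 : μ.real (Iic q) < 1) :
    0 < μ (Ioo a b) := by
  obtain ⟨f, -, hμ, hd, -, hpos⟩ := h
  have hopen : IsOpen {x | 0 < f x} := isOpen_lt continuous_const hd.continuous
  rw [← closure_Ioo hab.ne] at hq
  have hne : ({x | 0 < f x} ∩ Ioo a b).Nonempty :=
    mem_closure_iff.mp hq _ hopen (hpos q h0 h1)
  have hvol := (hopen.inter isOpen_Ioo).measure_pos volume hne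
  refine pos_iff_ne_zero.mpr fun hzero => hvol.ne' ?_
  rw [hμ, withDensity_apply _ measurableSet_Ioo, lintegral_eq_zero_iff
    (hd.continuous.measurable.ennreal_ofReal), Filter.EventuallyEq,
    ae_restrict_iff' measurableSet_Ioo] at hzero
  rw [← compl_compl ({x | 0 < f x} ∩ Ioo a b), ← mem_ae_iff]
  filter_upwards [hzero] with x hx hmem
  exact absurd (ENNReal.ofReal_eq_zero.mp (hx hmem.2)) (not_le.mpr hmem.1)

theorem integrable_checkLoss_sub [IsFiniteMeasure μ] {τ : ℝ} (hτ : τ ∈ Ioo (0 : ℝ) 1) (q q' : ℝ) :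
    Integrable (fun x => checkLoss τ (x - q) - checkLoss τ (x - q')) μ := by
  refine Integrable.of_bound (C := |q - q'|) ?_ (Eventually.of_forall fun x => ?_)
  · exact (((measurable_checkLoss τ).comp (measurable_id.sub_const q)).sub
      ((measurable_checkLoss τ).comp (measurable_id.sub_const q'))).aestronglyMeasurable
  · exact abs_checkLoss_sub_le hτ x q q'

/-- The quantile is the unique minimizer of the expected check loss. -/
theorem RegularDensity.integral_checkLoss_sub_pos [IsProbabilityMeasure μ] (h : RegularDensity μ)
    {τ : ℝ} (hτ : τ ∈ Ioo (0 : ℝ) 1) {q : ℝ} (hq : q ≠ quantile μ τ) :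
    0 < ∫ x, (checkLoss τ (x - q) - checkLoss τ (x - quantile μ τ)) ∂μ := by
  have hF := h.real_Iic_quantile hτ
  set q₀ := quantile μ τ with hq₀
  -- The loss gap is bounded below by a step function of this shape. Since `F(q₀) = τ`, its first
  -- two contributions cancel, and what remains is the mass between `q₀` and the midpoint `m` times
  -- half of `|q - q₀|`.
  have hstep : ∀ (s t : Set ℝ) (_ : MeasurableSet s) (_ : MeasurableSet t) (c d e : ℝ),
      Integrable (fun x => c + (s.indicator (fun _ => d) x + t.indicator (fun _ => e) x)) μ ∧
      ∫ x, (c + (s.indicator (fun _ => d) x + t.indicator (fun _ => e) x)) ∂μ =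
        c + (μ.real s * d + μ.real t * e) := by
    intro s t hs ht c d e
    have h1 : Integrable (fun x => s.indicator (fun _ => d) x) μ := (integrable_const d).indicator hs
    have h2 : Integrable (fun x => t.indicator (fun _ => e) x) μ := (integrable_const e).indicator ht
    have h3 : Integrable (fun x => s.indicator (fun _ => d) x + t.indicator (fun _ => e) x) μ :=
      h1.add h2
    refine ⟨(integrable_const c).add h3, ?_⟩
    rw [integral_add (integrable_const c) h3, integral_add h1 h2, integral_indicator_const _ hs,
      integral_indicator_const _ ht]
    simp
  obtain ⟨τ0, τ1⟩ := id hτ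
  have hFpos : 0 < μ.real (Iic q₀) := by rw [hF]; exact τ0
  have hFlt : μ.real (Iic q₀) < 1 := by rw [hF]; exact τ1
  rcases lt_or_gt_of_ne hq with hlt | hlt
  · set m := (q + q₀) / 2 with hm
    have hpos : 0 < μ.real (Ioc m q₀) := by
      refine ENNReal.toReal_pos (ne_of_gt ?_) (measure_ne_top _ _)
      exact (h.measure_Ioo_pos (a := m) (b := q₀) (by rw [hm]; linarith)
        ⟨by rw [hm]; linarith, le_rfl⟩ hFpos hFlt).trans_le (measure_mono Ioo_subset_Ioc_self)
    have hle : ∫ x, ((q₀ - q) * τ + ((Iic q₀).indicator (fun _ => -(q₀ - q)) x +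
        (Ioc m q₀).indicator (fun _ => m - q) x)) ∂μ ≤
        ∫ x, (checkLoss τ (x - q) - checkLoss τ (x - q₀)) ∂μ := by
      refine integral_mono (hstep _ _ measurableSet_Iic measurableSet_Ioc _ _ _).1 (integrable_checkLoss_sub hτ q q₀) fun x => ?_
      simp only [indicator_apply, mem_Iic, mem_Ioc, checkLoss]
      split_ifs <;> nlinarith
    refine lt_of_lt_of_le ?_ hle
    rw [(hstep _ _ measurableSet_Iic measurableSet_Ioc _ _ _).2, hF]
    have : 0 < μ.real (Ioc m q₀) * (m - q) := mul_pos hpos (by rw [hm]; linarith)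
    linarith
  · set m := (q + q₀) / 2 with hm
    have hpos : 0 < μ.real (Ioc q₀ m) := by
      refine ENNReal.toReal_pos (ne_of_gt ?_) (measure_ne_top _ _)
      exact (h.measure_Ioo_pos (a := q₀) (b := m) (by rw [hm]; linarith)
        ⟨le_rfl, by rw [hm]; linarith⟩ hFpos hFlt).trans_le (measure_mono Ioo_subset_Ioc_self)
    have hle : ∫ x, (-((q - q₀) * τ) + ((Iic q₀).indicator (fun _ => (q - q₀)) x +
        (Ioc q₀ m).indicator (fun _ => q - m) x)) ∂μ ≤
        ∫ x, (checkLoss τ (x - q) - checkLoss τ (x - q₀)) ∂μ := by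
      refine integral_mono (hstep _ _ measurableSet_Iic measurableSet_Ioc _ _ _).1 (integrable_checkLoss_sub hτ q q₀) fun x => ?_
      simp only [indicator_apply, mem_Iic, mem_Ioc, checkLoss]
      split_ifs <;> nlinarith
    refine lt_of_lt_of_le ?_ hle
    rw [(hstep _ _ measurableSet_Iic measurableSet_Ioc _ _ _).2, hF]
    have : 0 < μ.real (Ioc q₀ m) * (q - m) := mul_pos hpos (by rw [hm]; linarith)
    linarith

end Quantile

end QDAR

namespace QDAR

/-! ### Identification of the parameter -/

section Identification

open MvPolynomial

variable {p : ℕ}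

theorem sq_signedSqrt (x : ℝ) : signedSqrt x ^ 2 = |x| := by
  rw [← sq_abs, sq]
  conv_rhs => rw [← signedSqrt_mul_abs x, abs_mul, abs_abs]

/-- The linear form `∑ d_i v_i` as a polynomial. -/
noncomputable def linPoly (d : Fin p → ℝ) : MvPolynomial (Fin p) ℝ := ∑ i, C (d i) * X i

/-- The quadratic function `b + ∑ β_j v_j²` as a polynomial. -/
noncomputable def scalePoly (θ : Param p) : MvPolynomial (Fin p) ℝ :=
  C θ.2.1 + ∑ j, C (θ.2.2 j) * X j ^ 2

theorem eval_linPoly (d v : Fin p → ℝ) : eval v (linPoly d) = ∑ i, d i * v i := by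
  simp [linPoly]

theorem eval_scalePoly (θ : Param p) (v : Fin p → ℝ) :
    eval v (scalePoly θ) = θ.2.1 + ∑ j, θ.2.2 j * v j ^ 2 := by
  simp [scalePoly]

/-- The polynomial that vanishes where two quantile functions agree, if the arguments of the
signed square roots have the signs `s` and `s₀`. -/
noncomputable def agreePoly (θ θ₀ : Param p) (s s₀ : ℝ) : MvPolynomial (Fin p) ℝ :=
  (linPoly (θ.1 - θ₀.1) ^ 2 + C s₀ * scalePoly θ₀ - C s * scalePoly θ) ^ 2 -
    C (4 * s₀) * linPoly (θ.1 - θ₀.1) ^ 2 * scalePoly θ₀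

theorem exists_sign_mul_eq_abs (x : ℝ) : ∃ s : ℝ, (s = 1 ∨ s = -1) ∧ |x| = s * x := by
  rcases abs_choice x with h | h
  · exact ⟨1, Or.inl rfl, by rw [h, one_mul]⟩
  · exact ⟨-1, Or.inr rfl, by rw [h, neg_one_mul]⟩

/-- Let `S`, `S₀` be the signed roots and `L = S₀ - S` the difference of the linear parts. Then `L²
+ S₀² - S² = 2 L S₀`, and squaring leaves only `S² = |N|` and `S₀² = |N₀|`, which are polynomial
once the signs are fixed. -/
theorem eval_agreePoly_eq_zero {θ θ₀ : Param p} {v : Fin p → ℝ}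
    (h : condQuantileFun θ v = condQuantileFun θ₀ v) :
    ∃ s s₀ : ℝ, (s = 1 ∨ s = -1) ∧ (s₀ = 1 ∨ s₀ = -1) ∧ eval v (agreePoly θ θ₀ s s₀) = 0 := by
  obtain ⟨s, hs, hN⟩ := exists_sign_mul_eq_abs (θ.2.1 + ∑ j, θ.2.2 j * v j ^ 2)
  obtain ⟨s₀, hs₀, hN₀⟩ := exists_sign_mul_eq_abs (θ₀.2.1 + ∑ j, θ₀.2.2 j * v j ^ 2)
  refine ⟨s, s₀, hs, hs₀, ?_⟩
  unfold condQuantileFun at h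
  have hL : ∑ i, (θ.1 - θ₀.1) i * v i = signedSqrt (θ₀.2.1 + ∑ j, θ₀.2.2 j * v j ^ 2) -
      signedSqrt (θ.2.1 + ∑ j, θ.2.2 j * v j ^ 2) := by
    simp only [Pi.sub_apply, sub_mul, Finset.sum_sub_distrib]
    linarith
  have h1 : eval v (agreePoly θ θ₀ s s₀) =
      ((∑ i, (θ.1 - θ₀.1) i * v i) ^ 2 + s₀ * (θ₀.2.1 + ∑ j, θ₀.2.2 j * v j ^ 2) -
        s * (θ.2.1 + ∑ j, θ.2.2 j * v j ^ 2)) ^ 2 -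
      4 * (∑ i, (θ.1 - θ₀.1) i * v i) ^ 2 * (s₀ * (θ₀.2.1 + ∑ j, θ₀.2.2 j * v j ^ 2)) := by
    simp only [agreePoly, map_sub, map_add, map_mul, map_pow, eval_C, eval_linPoly, eval_scalePoly]
    ring
  rw [h1, ← hN, ← hN₀, ← sq_signedSqrt, ← sq_signedSqrt, hL]
  ring

/-- Along a ray `r • v` the identity is a polynomial in `r²`. Its constant term gives `s₀ b₀ = s b`;
then its `r²` coefficient is `-4 s₀ b₀ a²`, with `a` the linear form at `v`, so `b₀ ≠ 0` forces `a =
0`. -/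
theorem fst_eq_of_agreePoly_eq_zero {θ θ₀ : Param p} {s s₀ : ℝ} (hs₀ : s₀ ≠ 0)
    (hb : θ₀.2.1 ≠ 0) (h : agreePoly θ θ₀ s s₀ = 0) : θ.1 = θ₀.1 := by
  have hform : ∀ v : Fin p → ℝ, ∑ i, (θ.1 - θ₀.1) i * v i = 0 := by
    intro v
    have key : ∀ r : ℝ, (r ^ 2 * (∑ i, (θ.1 - θ₀.1) i * v i) ^ 2 +
        s₀ * (θ₀.2.1 + r ^ 2 * ∑ j, θ₀.2.2 j * v j ^ 2) -
        s * (θ.2.1 + r ^ 2 * ∑ j, θ.2.2 j * v j ^ 2)) ^ 2 -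
        4 * s₀ * (r ^ 2 * (∑ i, (θ.1 - θ₀.1) i * v i) ^ 2) *
          (θ₀.2.1 + r ^ 2 * ∑ j, θ₀.2.2 j * v j ^ 2) = 0 := by
      intro r
      have h1 := congrArg (eval (r • v)) h
      simp only [agreePoly, map_sub, map_add, map_mul, map_pow, eval_C, eval_linPoly,
        eval_scalePoly, map_zero, Pi.smul_apply, smul_eq_mul] at h1
      rw [← h1]
      have e1 : ∑ i, (θ.1 - θ₀.1) i * (r * v i) = r * ∑ i, (θ.1 - θ₀.1) i * v i := by
        rw [Finset.mul_sum]; exact Finset.sum_congr rfl fun i _ => by ring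
      have e2 : ∀ c : Fin p → ℝ, ∑ i, c i * (r * v i) ^ 2 = r ^ 2 * ∑ i, c i * v i ^ 2 := by
        intro c
        rw [Finset.mul_sum]; exact Finset.sum_congr rfl fun i _ => by ring
      rw [e1, e2, e2]
      ring
    set a := ∑ i, (θ.1 - θ₀.1) i * v i
    set n := ∑ j, θ.2.2 j * v j ^ 2
    set n₀ := ∑ j, θ₀.2.2 j * v j ^ 2
    have k0 := key 0
    have k1 := key 1
    have k2 := key 2
    have hsb : s₀ * θ₀.2.1 - s * θ.2.1 = 0 := by
      have : (s₀ * θ₀.2.1 - s * θ.2.1) ^ 2 = 0 := by linear_combination k0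
      exact pow_eq_zero_iff two_ne_zero |>.mp this
    -- The weights on the values at `r = 1` and `r = 2` cancel the `r⁴` coefficient and isolate the
    -- `r²` coefficient.
    have hfin : (s₀ * θ₀.2.1) * a ^ 2 = 0 := by
      linear_combination (-1 / 3) * k1 + (1 / 48) * k2 +
        (1 / 3 * (s₀ * θ₀.2.1 - s * θ.2.1 + 2 * (a ^ 2 + s₀ * n₀ - s * n)) -
         1 / 48 * (s₀ * θ₀.2.1 - s * θ.2.1 + 8 * (a ^ 2 + s₀ * n₀ - s * n))) * hsb
    exact pow_eq_zero_iff two_ne_zero |>.mp ((mul_eq_zero.mp hfin).resolve_left (mul_ne_zero hs₀ hb))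
  funext i
  have := hform (Pi.single i 1)
  simp [Pi.single_apply] at this
  linarith

/-- If no nonzero polynomial vanishes frequently along a filter, then the quantile function along
the filter identifies a parameter whose intercept in the scale part does not vanish. -/
theorem eq_of_frequently_condQuantileFun_eq {l : Filter (Fin p → ℝ)}
    (hl : ∀ Q : MvPolynomial (Fin p) ℝ, Q ≠ 0 → ∀ᶠ v in l, eval v Q ≠ 0) {θ θ₀ : Param p}
    (hb : θ₀.2.1 ≠ 0) (h : ∃ᶠ v in l, condQuantileFun θ v = condQuantileFun θ₀ v) : θ = θ₀ := by
  have hzero : ∀ Q : MvPolynomial (Fin p) ℝ, (∃ᶠ v in l, eval v Q = 0) → Q = 0 := by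
    intro Q hQ
    by_contra hne
    exact hQ (hl Q hne)
  have hφ : θ.1 = θ₀.1 := by
    -- The signs depend on `v`, so only the product over all four sign patterns vanishes frequently;
    -- the polynomial ring is a domain, so one factor is zero.
    have hprod : (agreePoly θ θ₀ 1 1 * agreePoly θ θ₀ 1 (-1)) *
        (agreePoly θ θ₀ (-1) 1 * agreePoly θ θ₀ (-1) (-1)) = 0 := by
      refine hzero _ (h.mono fun v hv => ?_)
      obtain ⟨s, s₀, rfl | rfl, rfl | rfl, h0⟩ := eval_agreePoly_eq_zero hv <;> simp [h0]
    rcases mul_eq_zero.mp hprod with h | h <;> rcases mul_eq_zero.mp h with h | h <;>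
      exact fst_eq_of_agreePoly_eq_zero (by norm_num) hb h
  have hN : scalePoly θ - scalePoly θ₀ = 0 := by
    refine hzero _ (h.mono fun v hv => ?_)
    rw [map_sub, eval_scalePoly, eval_scalePoly, sub_eq_zero]
    unfold condQuantileFun at hv
    rw [hφ] at hv
    exact signedSqrt_injective (add_left_cancel hv)
  have hev : ∀ v : Fin p → ℝ, θ.2.1 + ∑ j, θ.2.2 j * v j ^ 2 =
      θ₀.2.1 + ∑ j, θ₀.2.2 j * v j ^ 2 := by
    intro v
    rw [← eval_scalePoly, ← eval_scalePoly, sub_eq_zero.mp hN]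
  have hb' : θ.2.1 = θ₀.2.1 := by simpa using hev 0
  refine Prod.ext hφ (Prod.ext hb' (funext fun j => ?_))
  have := hev (Pi.single j 1)
  simpa [Pi.single_apply, hb'] using this

end Identification

/-! ### Conditioning on the past -/

section Conditioning

variable {Ω : Type*} [MeasurableSpace Ω] {P : Measure Ω} [IsProbabilityMeasure P] {y : ℤ → Ω → ℝ}

theorem measurable_past (hy : ∀ t, Measurable (y t)) (t : ℤ) : Measurable (past y t) :=
  measurable_pi_lambda _ fun _ => hy _

instance isProbabilityMeasure_condLaw (t : ℤ) (ω : Ω) : IsProbabilityMeasure (condLaw P y t ω) := by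
  unfold condLaw
  infer_instance

theorem map_past_prod (hy : ∀ t, Measurable (y t)) (t : ℤ) :
    P.map (fun ω => (past y (t - 1) ω, y t ω)) =
      (P.map (past y (t - 1))) ⊗ₘ condDistrib (y t) (past y (t - 1)) P :=
  (compProd_map_condDistrib (hy t).aemeasurable).symm

theorem ae_of_ae_condLaw (hy : ∀ t, Measurable (y t)) (t : ℤ) {s : Set ((ℕ → ℝ) × ℝ)}
    (hs : MeasurableSet s)
    (h : ∀ᵐ ω ∂P, ∀ᵐ z ∂(condLaw P y t ω), (past y (t - 1) ω, z) ∈ s) :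
    ∀ᵐ ω ∂P, (past y (t - 1) ω, y t ω) ∈ s := by
  have hpm := measurable_past hy (t - 1)
  have h1 : ∀ᵐ x ∂(P.map fun ω => (past y (t - 1) ω, y t ω)), x ∈ s := by
    rw [map_past_prod hy]
    refine (Measure.ae_compProd_iff hs).mpr ?_
    refine (ae_map_iff hpm.aemeasurable ?_).mpr h
    exact Kernel.measurable_kernel_prodMk_left (κ := condDistrib (y t) (past y (t - 1)) P)
      hs.compl (measurableSet_singleton 0)
  exact ae_of_ae_map (hpm.prodMk (hy t)).aemeasurable h1

theorem integral_past_prod (hy : ∀ t, Measurable (y t)) (t : ℤ) {h : (ℕ → ℝ) × ℝ → ℝ}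
    (hm : Measurable h) (hi : Integrable (fun ω => h (past y (t - 1) ω, y t ω)) P) :
    ∫ ω, h (past y (t - 1) ω, y t ω) ∂P = ∫ ω, ∫ z, h (past y (t - 1) ω, z) ∂(condLaw P y t ω) ∂P ∧
    Integrable (fun ω => ∫ z, h (past y (t - 1) ω, z) ∂(condLaw P y t ω)) P := by
  have hpm := measurable_past hy (t - 1)
  have hp := (hpm.prodMk (hy t))
  have hi' : Integrable h ((P.map (past y (t - 1))) ⊗ₘ condDistrib (y t) (past y (t - 1)) P) := by
    rw [← map_past_prod hy]
    exact (integrable_map_measure hm.aestronglyMeasurable hp.aemeasurable).mpr hi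
  have hii := hi'.integral_compProd
  constructor
  · rw [← integral_map (φ := fun ω => (past y (t - 1) ω, y t ω)) hp.aemeasurable
      hm.aestronglyMeasurable, map_past_prod hy, Measure.integral_compProd hi']
    exact integral_map hpm.aemeasurable hii.aestronglyMeasurable
  · exact hii.comp_measurable hpm

theorem RegularDensity.nullSingletonClass {μ : Measure ℝ} (h : RegularDensity μ) : NullSingletonClass μ := by
  obtain ⟨f, -, rfl, -⟩ := h
  exact ⟨fun x => withDensity_absolutelyContinuous _ _ (measure_singleton x)⟩

/-- If the conditional laws given the past have no atoms, then the recent past almost surely is not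
a zero of a given nonzero polynomial. -/
theorem ae_eval_ne_zero (hy : ∀ t, Measurable (y t))
    (hna : ∀ t, ∀ᵐ ω ∂P, NullSingletonClass (condLaw P y t ω)) (n : ℕ) :
    ∀ (t : ℤ) (Q : MvPolynomial (Fin n) ℝ), Q ≠ 0 →
      ∀ᵐ ω ∂P, MvPolynomial.eval (fun i : Fin n => past y t ω i) Q ≠ 0 := by
  induction n with
  | zero =>
    intro t Q hQ
    refine Eventually.of_forall fun ω h0 => hQ ?_
    rw [MvPolynomial.eq_C_of_isEmpty Q] at h0 ⊢
    rw [MvPolynomial.eval_C] at h0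
    rw [h0, map_zero]
  | succ n ih =>
    intro t Q hQ
    -- Read `Q` as a polynomial in the newest value `y_t` with coefficients in the older ones. By
    -- induction its leading coefficient is almost surely nonzero on the older values, so only
    -- finitely many values of `y_t` are roots, a null set for the conditional law.
    have hne : MvPolynomial.finSuccEquiv ℝ n Q ≠ 0 := by
      rwa [Ne, EmbeddingLike.map_eq_zero_iff]
    have hlead := ih (t - 1) _ (Polynomial.leadingCoeff_ne_zero.mpr hne)
    have hcons : ∀ ω, (fun i : Fin (n + 1) => past y t ω i) =
        (Fin.cons (y t ω) (fun i : Fin n => past y (t - 1) ω i) : Fin (n + 1) → ℝ) := by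
      intro ω
      funext i
      refine Fin.cases ?_ (fun i => ?_) i
      · simp [past]
      · simp only [past, Fin.cons_succ, Fin.val_succ]
        congr 1
        push_cast
        ring
    set s : Set ((ℕ → ℝ) × ℝ) := {x | MvPolynomial.eval
      (Fin.cons x.2 (fun i : Fin n => x.1 i) : Fin (n + 1) → ℝ) Q ≠ 0} with hs
    have hsm : MeasurableSet s := by
      have hc : Measurable fun x : (ℕ → ℝ) × ℝ =>
          (Fin.cons x.2 (fun i : Fin n => x.1 i) : Fin (n + 1) → ℝ) := by
        refine measurable_pi_lambda _ fun i => ?_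
        refine Fin.cases ?_ (fun i => ?_) i
        · simpa using measurable_snd
        · exact (measurable_pi_apply (i : ℕ)).comp measurable_fst
      have := (MvPolynomial.continuous_eval Q).measurable.comp hc
      exact (this (measurableSet_singleton 0)).compl
    have hae := ae_of_ae_condLaw (P := P) hy t hsm ?_
    · filter_upwards [hae] with ω hω
      rw [hcons]
      exact hω
    · filter_upwards [hlead, hna t] with ω hω hatom
      set q := Polynomial.map (MvPolynomial.eval fun i : Fin n => past y (t - 1) ω i)
        (MvPolynomial.finSuccEquiv ℝ n Q) with hq
      have hq0 : q ≠ 0 := by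
        intro h0
        apply hω
        have := congrArg (fun r => Polynomial.coeff r
          (MvPolynomial.finSuccEquiv ℝ n Q).natDegree) h0
        simpa [hq, Polynomial.coeff_map] using this
      have hfin : (q.rootSet ℝ).Finite := Polynomial.rootSet_finite q ℝ
      filter_upwards [measure_eq_zero_iff_ae_notMem.mp (hfin.measure_zero (condLaw P y t ω))]
        with z hz hz0
      refine hz ?_
      rw [Polynomial.mem_rootSet]
      refine ⟨hq0, ?_⟩
      rw [MvPolynomial.eval_eq_eval_mv_eval'] at hz0
      simpa using hz0

end Conditioning

end QDAR

namespace QDAR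

variable {Ω : Type*} [MeasurableSpace Ω] {P : Measure Ω} [IsProbabilityMeasure P]
  {p : ℕ} {y w : ℤ → Ω → ℝ}

/-! ### The expected loss -/

/-- The difference of the check losses at `θ` and at `θ₀`, for lags `v` and next value `z`. -/
noncomputable def lossGap (τ : ℝ) (θ θ₀ : Param p) (v : Fin p → ℝ) (z : ℝ) : ℝ :=
  checkLoss τ (z - condQuantileFun θ v) - checkLoss τ (z - condQuantileFun θ₀ v)

theorem measurable_lossGap {τ : ℝ} (θ θ₀ : Param p) {α : Type*} [MeasurableSpace α]
    {v : α → Fin p → ℝ} {z : α → ℝ} (hv : Measurable v) (hz : Measurable z) :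
    Measurable fun x => lossGap τ θ θ₀ (v x) (z x) :=
  ((measurable_checkLoss τ).comp (hz.sub ((measurable_condQuantileFun θ).comp hv))).sub
    ((measurable_checkLoss τ).comp (hz.sub ((measurable_condQuantileFun θ₀).comp hv)))

theorem abs_lossGap_le {τ : ℝ} (hτ : τ ∈ Ioo (0 : ℝ) 1) {θ θ₀ : Param p} {r : ℝ}
    (h : dist θ θ₀ ≤ r) (v : Fin p → ℝ) (z : ℝ) :
    |lossGap τ θ θ₀ v z| ≤ (p * r + 2 * √r) * (1 + √(∑ i, v i ^ 2)) :=
  (abs_checkLoss_sub_le hτ _ _ _).trans (abs_condQuantileFun_sub_le h v)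

theorem measurable_lags (hy : ∀ t, Measurable (y t)) (t : ℤ) : Measurable (lags p y t) :=
  measurable_pi_lambda _ fun _ => hy _

theorem measurable_lagsNorm (hy : ∀ t, Measurable (y t)) (t : ℤ) : Measurable (lagsNorm p y t) :=
  (Finset.measurable_sum _ fun i _ =>
    ((measurable_pi_apply i).comp (measurable_lags hy t)).pow_const 2).sqrt

theorem integrable_mul_one_add_lagsNorm {P : Measure Ω} (hy : ∀ t, Measurable (y t)) {t : ℤ}
    (hw0 : ∀ᵐ ω ∂P, 0 ≤ w t ω) (hwi : Integrable (w t) P)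
    (hwm : Integrable (fun ω => w t ω * lagsNorm p y t ω ^ 3) P) :
    Integrable (fun ω => w t ω * (1 + lagsNorm p y t ω)) P := by
  refine ((hwi.const_mul 2).add hwm).mono'
    (hwi.1.mul (measurable_const.add (measurable_lagsNorm hy t)).aestronglyMeasurable) ?_
  filter_upwards [hw0] with ω h0
  have hL : 0 ≤ lagsNorm p y t ω := Real.sqrt_nonneg _
  rw [Real.norm_eq_abs, abs_of_nonneg (mul_nonneg h0 (by linarith))]
  -- Uses `L ≤ 1 + L³` for `L ≥ 0`, so the weighted third moment controls the weighted first one.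
  have : 1 + lagsNorm p y t ω ≤ 2 + lagsNorm p y t ω ^ 3 := by
    nlinarith [mul_nonneg hL (sq_nonneg (lagsNorm p y t ω - 1)),
      sq_nonneg (lagsNorm p y t ω - 1)]
  calc w t ω * (1 + lagsNorm p y t ω) ≤ w t ω * (2 + lagsNorm p y t ω ^ 3) :=
        mul_le_mul_of_nonneg_left this h0
    _ = 2 * w t ω + w t ω * lagsNorm p y t ω ^ 3 := by ring

theorem integrable_mul_lossGap {P : Measure Ω} (hy : ∀ t, Measurable (y t)) {τ : ℝ} (hτ : τ ∈ Ioo (0 : ℝ) 1)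
    {t : ℤ} (hw0 : ∀ᵐ ω ∂P, 0 ≤ w t ω) (hwi : Integrable (w t) P)
    (hwm : Integrable (fun ω => w t ω * lagsNorm p y t ω ^ 3) P) (θ θ₀ : Param p) :
    Integrable (fun ω => w t ω * lossGap τ θ θ₀ (lags p y t ω) (y t ω)) P := by
  refine ((integrable_mul_one_add_lagsNorm hy hw0 hwi hwm).const_mul
    (p * dist θ θ₀ + 2 * √(dist θ θ₀))).mono'
    (hwi.1.mul (measurable_lossGap θ θ₀ (measurable_lags hy t) (hy t)).aestronglyMeasurable) ?_
  filter_upwards [hw0] with ω h0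
  rw [Real.norm_eq_abs, abs_mul, abs_of_nonneg h0]
  calc w t ω * |lossGap τ θ θ₀ (lags p y t ω) (y t ω)|
      ≤ w t ω * ((p * dist θ θ₀ + 2 * √(dist θ θ₀)) * (1 + lagsNorm p y t ω)) :=
        mul_le_mul_of_nonneg_left (abs_lossGap_le hτ le_rfl _ _) h0
    _ = _ := by ring

/-- The weighted expected loss is uniquely minimized by the true parameter. -/
theorem integral_mul_lossGap_pos (hy : ∀ t, Measurable (y t)) {τ : ℝ} (hτ : τ ∈ Ioo (0 : ℝ) 1)
    (hdens : ∀ t, ∀ᵐ ω ∂P, RegularDensity (condLaw P y t ω)) {θ₀ : Param p} (hb : θ₀.2.1 ≠ 0)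
    {t : ℤ} (hq : ∀ᵐ ω ∂P, quantile (condLaw P y t ω) τ = condQuantileFun θ₀ (lags p y t ω))
    (hw0 : ∀ᵐ ω ∂P, 0 ≤ w t ω) (hwi : Integrable (w t) P)
    (hwm : Integrable (fun ω => w t ω * lagsNorm p y t ω ^ 3) P)
    (hwmeas : Measurable[pastSigma y (t - 1)] (w t)) (hwne : ¬ (w t =ᵐ[P] 0))
    {θ : Param p} (hθ : θ ≠ θ₀) :
    0 < ∫ ω, w t ω * lossGap τ θ θ₀ (lags p y t ω) (y t ω) ∂P := by
  obtain ⟨G, hG, hwG⟩ := hwmeas.exists_eq_measurable_comp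
  have hwG' : ∀ ω, w t ω = G (past y (t - 1) ω) := fun ω => congrFun hwG ω
  set H : (ℕ → ℝ) × ℝ → ℝ := fun x => G x.1 * lossGap τ θ θ₀ (fun i => x.1 i) x.2 with hH
  have hHm : Measurable H := (hG.comp measurable_fst).mul (measurable_lossGap θ θ₀
    (measurable_pi_lambda _ fun i => (measurable_pi_apply (i : ℕ)).comp measurable_fst)
    measurable_snd)
  have hHeq : (fun ω => w t ω * lossGap τ θ θ₀ (lags p y t ω) (y t ω)) =
      fun ω => H (past y (t - 1) ω, y t ω) := by
    funext ω
    rw [hwG']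
    rfl
  have hint := integrable_mul_lossGap (P := P) hy hτ hw0 hwi hwm θ θ₀
  rw [hHeq] at hint ⊢
  obtain ⟨heq, hinner⟩ := integral_past_prod hy t hHm hint
  have hform : ∀ ω, ∫ z, H (past y (t - 1) ω, z) ∂(condLaw P y t ω) =
      w t ω * ∫ z, lossGap τ θ θ₀ (lags p y t ω) z ∂(condLaw P y t ω) := by
    intro ω
    rw [hwG', ← integral_const_mul]
    rfl
  have hpos : ∀ᵐ ω ∂P, condQuantileFun θ (lags p y t ω) ≠ condQuantileFun θ₀ (lags p y t ω) →
      0 < ∫ z, lossGap τ θ θ₀ (lags p y t ω) z ∂(condLaw P y t ω) := by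
    filter_upwards [hdens t, hq] with ω hd hqω hne
    have := hd.integral_checkLoss_sub_pos hτ (q := condQuantileFun θ (lags p y t ω))
      (by rwa [hqω])
    rw [hqω] at this
    exact this
  have hnn : 0 ≤ᵐ[P] fun ω => ∫ z, H (past y (t - 1) ω, z) ∂(condLaw P y t ω) := by
    filter_upwards [hpos, hw0] with ω h1 h0
    rw [Pi.zero_apply, hform]
    refine mul_nonneg h0 ?_
    by_cases hc : condQuantileFun θ (lags p y t ω) = condQuantileFun θ₀ (lags p y t ω)
    · simp [lossGap, hc]
    · exact (h1 hc).le
  rw [heq]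
  refine lt_of_le_of_ne (integral_nonneg_of_ae hnn) fun h0 => hθ ?_
  have hz := (integral_eq_zero_iff_of_nonneg_ae hnn hinner).mp h0.symm
  refine eq_of_frequently_condQuantileFun_eq (l := (ae P).map (lags p y t)) ?_ hb ?_
  · intro Q hQ
    exact ae_eval_ne_zero hy (fun t => (hdens t).mono fun ω h => h.nullSingletonClass) p (t - 1) Q hQ
  -- The weight is nonzero only on an event of positive probability, so agreement is known only
  -- frequently; this is why identification is phrased with `∃ᶠ`.
  · have hfreq : ∃ᶠ ω in ae P, w t ω ≠ 0 := fun h => hwne (h.mono fun ω hω => not_not.mp hω)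
    refine (hfreq.and_eventually (hz.and hpos)).mono ?_
    rintro ω ⟨hne, hzω, hposω⟩
    by_contra hc
    replace hzω : ∫ z, H (past y (t - 1) ω, z) ∂(condLaw P y t ω) = 0 := hzω
    rw [hform] at hzω
    exact (mul_ne_zero hne (hposω hc).ne') hzω

/-! ### Laws of large numbers along the process -/

theorem iterate_shift_apply {E : Type*} (x : ℤ → E) (k : ℕ) (t : ℤ) :
    shift^[k] x t = x (t + k) := by
  induction k generalizing x with
  | zero => simp
  | succ k ih =>
    rw [Function.iterate_succ_apply, ih]
    unfold shift
    congr 1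
    push_cast
    ring

/-- Sums along an ergodic process of a functional with positive mean tend to infinity. -/
theorem StationaryErgodic.tendsto_sum_atTop (h : StationaryErgodic P y)
    (hy : ∀ t, Measurable (y t)) {F : (ℤ → ℝ) → ℝ} (hF : Measurable F)
    (hi : Integrable (fun ω => F fun s => y s ω) P) (hpos : 0 < ∫ ω, F (fun s => y s ω) ∂P) :
    ∀ᵐ ω ∂P, Tendsto (fun n => ∑ k ∈ Finset.range n, F fun s => y (s + k) ω) atTop atTop := by
  have hY : Measurable fun ω => fun s => y s ω := measurable_pi_lambda _ hy
  have hprob : IsProbabilityMeasure (pathLaw P y) :=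
    Measure.isProbabilityMeasure_map hY.aemeasurable
  have hi' : Integrable F (pathLaw P y) :=
    (integrable_map_measure hF.aestronglyMeasurable hY.aemeasurable).mpr hi
  have hpos' : 0 < ∫ x, F x ∂(pathLaw P y) := by
    rw [pathLaw, integral_map hY.aemeasurable hF.aestronglyMeasurable]
    exact hpos
  have hlim := Ergodic.tendsto_birkhoffSum_atTop (μ := pathLaw P y) h hF hi' hpos'
  filter_upwards [ae_of_ae_map hY.aemeasurable hlim] with ω hω
  refine hω.congr fun n => Finset.sum_congr rfl fun k _ => congrArg F ?_
  funext s
  exact iterate_shift_apply _ k s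

/-- A process that is jointly stationary with `y` and given at time `0` by a functional of the
past is given by the same functional at all later times. -/
theorem StrictlyStationary.ae_eq_comp_past {P : Measure Ω}
    (h : StrictlyStationary P (fun t ω => (y t ω, w t ω))) (hy : ∀ t, Measurable (y t))
    (hw : ∀ t, Measurable (w t)) {G : (ℕ → ℝ) → ℝ} (hG : Measurable G)
    (h0 : ∀ᵐ ω ∂P, w 0 ω = G (past y (-1) ω)) (t : ℕ) :
    ∀ᵐ ω ∂P, w t ω = G (past y (t - 1) ω) := by
  have hX : Measurable fun ω => fun s => (y s ω, w s ω) :=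
    measurable_pi_lambda _ fun s => (hy s).prodMk (hw s)
  -- Measurability alone would give a functional depending on `t`. Here `A (t + 1)` is the preimage
  -- of `A t` under the shift, so the time-zero `G` works at every later time.
  set A : ℤ → Set (ℤ → ℝ × ℝ) := fun t => {x | (x t).2 = G fun k => (x (t - 1 - k)).1} with hA
  have hAm : ∀ t, MeasurableSet (A t) := by
    intro t
    refine measurableSet_eq_fun (measurable_snd.comp (measurable_pi_apply t)) (hG.comp ?_)
    exact measurable_pi_lambda _ fun k => measurable_fst.comp (measurable_pi_apply _)
  have hstep : ∀ t : ℕ, ∀ᵐ x ∂(pathLaw P fun t ω => (y t ω, w t ω)), x ∈ A t := by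
    intro t
    induction t with
    | zero =>
      refine (ae_map_iff hX.aemeasurable (hAm _)).mpr ?_
      filter_upwards [h0] with ω hω
      have e : (past y (-1) ω) = fun k : ℕ => y (((0 : ℕ) : ℤ) - 1 - k) ω := by
        simp [past, funext_iff]
      rw [e] at hω
      exact hω
    | succ t ih =>
      filter_upwards [MeasurePreserving.quasiMeasurePreserving h |>.ae ih] with x hx
      have e : ∀ k : ℕ, ((t : ℤ) - 1 - k + 1) = ((t + 1 : ℕ) : ℤ) - 1 - k := by
        intro k; push_cast; ring
      simp only [hA, shift, mem_ofPred_eq, e] at hx ⊢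
      exact_mod_cast hx
  exact ae_of_ae_map hX.aemeasurable (hstep t)

/-! ### Consistency -/

theorem objective_sub {Ω : Type*} {y w : ℤ → Ω → ℝ} {τ : ℝ} {n : ℕ} {θ θ₀ : Param p} {ω : Ω} :
    objective y w τ n θ ω - objective y w τ n θ₀ ω =
      ∑ t ∈ Finset.Icc (p + 1) n,
        w (t : ℤ) ω * lossGap τ θ θ₀ (lags p y (t : ℤ) ω) (y (t : ℤ) ω) := by
  unfold objective
  rw [← Finset.sum_sub_distrib]
  exact Finset.sum_congr rfl fun t _ => (mul_sub _ _ _).symm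

/-- The functional of the path that bounds from below the contribution of one time to the
difference of the objective functions. -/
noncomputable def pathGap (τ : ℝ) (θ θ₀ : Param p) (c : ℝ) (G : (ℕ → ℝ) → ℝ) (x : ℤ → ℝ) : ℝ :=
  G (fun k => x (-1 - k)) * (lossGap τ θ θ₀ (fun i => x (-1 - (i : ℕ))) (x 0) -
    c * (1 + √(∑ i : Fin p, x (-1 - (i : ℕ)) ^ 2)))

theorem measurable_pathGap {τ : ℝ} (θ θ₀ : Param p) (c : ℝ) {G : (ℕ → ℝ) → ℝ}
    (hG : Measurable G) : Measurable (pathGap τ θ θ₀ c G) := by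
  refine (hG.comp (measurable_pi_lambda _ fun k => measurable_pi_apply _)).mul
    ((measurable_lossGap θ θ₀ (measurable_pi_lambda _ fun i => measurable_pi_apply _)
      (measurable_pi_apply 0)).sub (measurable_const.mul (measurable_const.add ?_)))
  exact Measurable.sqrt (by fun_prop)

theorem pathGap_shift {Ω : Type*} {y : ℤ → Ω → ℝ} {τ : ℝ} (θ θ₀ : Param p) (c : ℝ) (G : (ℕ → ℝ) → ℝ) (t : ℤ) (ω : Ω) :
    pathGap τ θ θ₀ c G (fun s => y (s + t) ω) = G (past y (t - 1) ω) *
      (lossGap τ θ θ₀ (lags p y t ω) (y t ω) - c * (1 + lagsNorm p y t ω)) := by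
  have e : ∀ k : ℕ, (-1 - (k : ℤ) + t) = t - 1 - k := fun k => by ring
  unfold pathGap lagsNorm lags past
  simp only [e, zero_add]

/-- On a ball of radius `r` the loss gap varies by at most `c * (1 + ‖lags‖)` with `c = p * r + 2 *
√r`. Subtracting this gives one lower bound for the whole ball, whose mean `D - c * K` is positive
for small `r`. With `w_t = G(past)` it is a functional of the path of `y` alone, so ergodicity of
`y` suffices. -/
theorem eventually_objective_lt_near (hy : ∀ t, Measurable (y t)) {τ : ℝ}
    (hτ : τ ∈ Ioo (0 : ℝ) 1) (hdens : ∀ t, ∀ᵐ ω ∂P, RegularDensity (condLaw P y t ω))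
    (hy_erg : StationaryErgodic P y)
    (hyw_stat : StrictlyStationary P (fun t ω => (y t ω, w t ω)))
    (hw0 : ∀ t, ∀ᵐ ω ∂P, 0 ≤ w t ω) (hwmeas : ∀ t, Measurable[pastSigma y (t - 1)] (w t))
    (hwm : ∀ t, Integrable (fun ω => w t ω * lagsNorm p y t ω ^ 3) P)
    (hwi : ∀ t, Integrable (w t) P) (hwne : ∀ t, ¬ (w t =ᵐ[P] 0)) {θ₀ : Param p}
    (hb : θ₀.2.1 ≠ 0)
    (hq : ∀ t, ∀ᵐ ω ∂P, quantile (condLaw P y t ω) τ = condQuantileFun θ₀ (lags p y t ω))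
    {θ₁ : Param p} (hθ : θ₁ ≠ θ₀) :
    ∃ r > 0, ∀ᵐ ω ∂P, ∀ᶠ n in atTop, ∀ θ ∈ Metric.closedBall θ₁ r,
      objective y w τ n θ₀ ω < objective y w τ n θ ω := by
  have hD := integral_mul_lossGap_pos hy hτ hdens hb (hq 0) (hw0 0) (hwi 0) (hwm 0) (hwmeas 0)
    (hwne 0) hθ
  have hDi := integrable_mul_lossGap hy hτ (hw0 0) (hwi 0) (hwm 0) θ₁ θ₀
  have hKi := integrable_mul_one_add_lagsNorm hy (hw0 0) (hwi 0) (hwm 0)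
  set D := ∫ ω, w 0 ω * lossGap τ θ₁ θ₀ (lags p y 0 ω) (y 0 ω) ∂P
  set K := ∫ ω, w 0 ω * (1 + lagsNorm p y 0 ω) ∂P
  obtain ⟨r, hr, hrD⟩ : ∃ r > 0, 0 < D - (p * r + 2 * √r) * K := by
    have hc : Continuous fun r : ℝ => D - (p * r + 2 * √r) * K := by fun_prop
    have h0 : ∀ᶠ r in 𝓝 (0 : ℝ), 0 < D - (p * r + 2 * √r) * K :=
      hc.continuousAt.eventually (lt_mem_nhds (by simpa using hD))
    obtain ⟨r, h1, h2⟩ := ((h0.filter_mono nhdsWithin_le_nhds).and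
      (self_mem_nhdsWithin (s := Ioi (0 : ℝ)))).exists
    exact ⟨r, h2, h1⟩
  refine ⟨r, hr, ?_⟩
  set c := p * r + 2 * √r
  have hwm' : ∀ t, Measurable (w t) := fun t =>
    (hwmeas t).mono (measurable_past hy (t - 1)).comap_le le_rfl
  obtain ⟨G, hG, hwG⟩ := (hwmeas 0).exists_eq_measurable_comp
  have hwt := hyw_stat.ae_eq_comp_past hy hwm' hG
    (Eventually.of_forall fun ω => congrFun hwG ω)
  have hpath0 : (fun ω => pathGap τ θ₁ θ₀ c G fun s => y s ω) = fun ω =>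
      w 0 ω * lossGap τ θ₁ θ₀ (lags p y 0 ω) (y 0 ω) - c * (w 0 ω * (1 + lagsNorm p y 0 ω)) := by
    funext ω
    have h1 := pathGap_shift (y := y) (τ := τ) θ₁ θ₀ c G 0 ω
    have h2 : w 0 ω = G (past y (0 - 1) ω) := congrFun hwG ω
    simp only [add_zero] at h1
    rw [h1, h2]
    ring
  have hsum := hy_erg.tendsto_sum_atTop hy (measurable_pathGap (τ := τ) θ₁ θ₀ c hG)
    (by rw [hpath0]; exact hDi.sub (hKi.const_mul c))
    (by rw [hpath0, integral_sub hDi (hKi.const_mul c), integral_const_mul]; exact hrD)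
  filter_upwards [hsum, ae_all_iff.mpr hwt, ae_all_iff.mpr fun t : ℕ => hw0 t] with ω hω hwω hnn
  -- The objective starts at `t = p + 1`: the sum over `range (n + 1)` must eventually exceed the
  -- fixed initial block `k ≤ p`.
  have hev := (hω.comp (tendsto_add_atTop_nat 1)).eventually_gt_atTop
    (∑ k ∈ Finset.range (p + 1), pathGap τ θ₁ θ₀ c G fun s => y (s + k) ω)
  filter_upwards [hev, eventually_ge_atTop p] with n hn hpn θ hθr
  rw [← sub_pos, objective_sub]
  have hsplit : 0 < ∑ t ∈ Finset.Icc (p + 1) n, pathGap τ θ₁ θ₀ c G fun s => y (s + t) ω := by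
    have : Finset.Icc (p + 1) n = Finset.Ico (p + 1) (n + 1) := by ext; simp
    rw [this, Finset.sum_Ico_eq_sub _ (by omega), sub_pos]
    exact hn
  refine hsplit.trans_le (Finset.sum_le_sum fun t _ => ?_)
  rw [pathGap_shift, ← hwω]
  refine mul_le_mul_of_nonneg_left ?_ (hnn t)
  have h1 := abs_lossGap_le hτ (Metric.mem_closedBall.mp hθr) (lags p y t ω) (y t ω)
  have h2 := (abs_le.mp h1).1
  have h3 : lossGap τ θ θ₁ (lags p y t ω) (y t ω) + lossGap τ θ₁ θ₀ (lags p y t ω) (y t ω) =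
      lossGap τ θ θ₀ (lags p y t ω) (y t ω) := sub_add_sub_cancel _ _ _
  rw [← h3]
  have h4 : -(c * (1 + lagsNorm p y t ω)) ≤ lossGap τ θ θ₁ (lags p y t ω) (y t ω) := h2
  linarith

end QDAR

theorem theorem2 {Ω : Type*} [MeasurableSpace Ω] (P : Measure Ω) [IsProbabilityMeasure P]
    (p : ℕ) (y w : ℤ → Ω → ℝ) (hy_meas : ∀ t, Measurable (y t))
    -- the model, the quantile level and the parameter space
    (φ : Fin p → ℝ → ℝ) (b : ℝ → ℝ) (β : Fin p → ℝ → ℝ) (hmodel : IsQDAR P y φ b β)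
    (τ : ℝ) (hτ : τ ∈ Ioo (0 : ℝ) 1)
    (Θ : Set (Param p)) (hΘ : IsCompact Θ) (hθ₀ : paramAt φ b β τ ∈ interior Θ)
    -- `y` is strictly stationary and ergodic with a fractional moment
    (hy_erg : StationaryErgodic P y)
    (κ : ℝ) (hκ : κ ∈ Ioc (0 : ℝ) 1) (hy_mom : ∀ t, Integrable (fun ω => |y t ω| ^ κ) P)
    -- the weights
    (hw_erg : StationaryErgodic P w)
    (hyw_stat : StrictlyStationary P (fun t ω => (y t ω, w t ω)))
    (hw_nonneg : ∀ t, ∀ᵐ ω ∂P, 0 ≤ w t ω)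
    (hw_meas : ∀ t, Measurable[pastSigma y (t - 1)] (w t))
    (hw_mom : ∀ t, Integrable (fun ω => w t ω * lagsNorm p y t ω ^ 3) P)
    (hw_int : ∀ t, Integrable (w t) P)
    (hw_ne : ∀ t, ¬ (w t =ᵐ[P] 0))
    -- the conditional density
    (hdens : ∀ t, ∀ᵐ ω ∂P, RegularDensity (condLaw P y t ω))
    -- coefficients bounded away from zero
    (C : ℝ) (hC : 0 < C) (hb : C ≤ |b τ|) (hβ : ∀ j, C ≤ |β j τ|)
    -- the estimator
    (est : ℕ → Ω → Param p) (hest : IsSelfWeightedCQE P y w τ Θ est) :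
    ∀ᵐ ω ∂P, Tendsto (fun n => est n ω) atTop (𝓝 (paramAt φ b β τ)) := by
  set θ₀ := paramAt φ b β τ with hθ₀def
  have hb0 : θ₀.2.1 ≠ 0 := abs_pos.mp (hC.trans_le hb)
  have hmem : θ₀ ∈ Θ := interior_subset hθ₀
  have hfar : ∀ k : ℕ, ∀ᵐ ω ∂P, ∀ᶠ n in atTop, ∀ θ ∈ Θ \ Metric.ball θ₀ (1 / (k + 1)),
      objective y w τ n θ₀ ω < objective y w τ n θ ω := by
    intro k
    -- Compactness reduces the claim to a neighbourhood of each point, so only finitely many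
    -- exceptional null sets and thresholds in `n` are combined.
    refine (hΘ.diff Metric.isOpen_ball).induction_on
      (p := fun s => ∀ᵐ ω ∂P, ∀ᶠ n in atTop, ∀ θ ∈ s,
        objective y w τ n θ₀ ω < objective y w τ n θ ω) ?_ ?_ ?_ ?_
    · simp
    · intro s t hst ht
      filter_upwards [ht] with ω hω
      filter_upwards [hω] with n hn θ hθ using hn θ (hst hθ)
    · intro s t hs ht
      filter_upwards [hs, ht] with ω h1 h2
      filter_upwards [h1, h2] with n h1 h2 θ hθ using hθ.elim (h1 θ) (h2 θ)
    · intro θ₁ hθ₁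
      have hne : θ₁ ≠ θ₀ := by
        rintro rfl
        exact hθ₁.2 (Metric.mem_ball_self (by positivity))
      obtain ⟨r, hr, h⟩ := eventually_objective_lt_near hy_meas hτ hdens hy_erg hyw_stat hw_nonneg
        hw_meas hw_mom hw_int hw_ne hb0 (fun t => hmodel.quantile_eq t τ hτ) hne
      exact ⟨_, mem_nhdsWithin_of_mem_nhds (Metric.closedBall_mem_nhds θ₁ hr), h⟩
  filter_upwards [ae_all_iff.mpr hfar, hest] with ω hω hestω
  refine Metric.tendsto_nhds.mpr fun ε hε => ?_
  obtain ⟨k, hk⟩ := exists_nat_one_div_lt hε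
  filter_upwards [hω k] with n hn
  by_contra hcon
  have hout : est n ω ∈ Θ \ Metric.ball θ₀ (1 / (k + 1)) :=
    ⟨(hestω n).1, fun hin => hcon ((Metric.mem_ball.mp hin).trans hk)⟩
  exact absurd ((hestω n).2 θ₀ hmem) (not_le.mpr (hn _ hout))
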